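/- **Setting.** All sequences are binary. An infinite sequence $a=(a_0,a_1,\dots)$ has *nonlinear complexity* $\omega$ if $\omega$ is the least $m\ge 0$ for which there is a function $f:\mathbb{Z}_2^m\to\mathbb{Z}_2$ with $a_{i+m}=f(a_i,\dots,a_{i+m-1})$ for all $i\ge 0$ (the length of the shortest feedback shift register generating $a$). $\mathcal{P}(n,\omega)$ is the set of binary sequences with least period $n$ and nonlinear complexity $\omega$. For a finite sequence $\mathbf{s}_n=(s_0,\dots,s_{n-1})$, $\mathbf{s}_n^\infty$ is its periodic repetition, $L(\mathbf{s}_n)=(s_1,\dots,s_{n-1},s_0)$, and $R^k=L^{n-k}$. A finite sequence is *aperiodic* if it is not a repetition of a shorter sequence. Two sets $S_1,S_2$ of sequences of period $n$ are *cyclic shift equivalent*, $S_1\cong S_2$, if the sets of all shifts of their members coincide. For $1\le c<n$ and $1\le d\le\min\{n-c,\lfloor n/2\rfloor\}$, let $\mathcal{B}(n,c,d)$ be the set of aperiodic $\mathbf{s}_n\in\mathbb{Z}_2^n$ such that $(s_0,\dots,s_{d-1})$ is aperiodic, $s_i=s_{i \bmod d}$ for $0\le i<c+d-1$, and $s_{c+d-1}\neq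 s_{(c+d-1)\bmod d}$. Let $\mathcal{B}(n,c)=\bigcup_d\mathcal{B}(n,c,d)$ (so that $\mathcal{B}(n,c)=\emptyset$ for $c\ge n$). For $\mathbf{s}_n\in\mathcal{B}(n,c,d)$, $add(\mathbf{s}_n)$ (with respect to $d$) is the integer $t\ge 0$ with $s_{n-1-i}=s_{(d-1-i)\bmod d}$ for $0\le i<t$ and $s_{n-1-t}\ne s_{(d-1-t)\bmod d}$. Let $\mathcal{B}_0(n,c)$ be the set of $\mathbf{s}_n\in\mathcal{B}(n,c)$ with $add(\mathbf{s}_n)=0$ (for some $d$ with $\mathbf{s}_n\in\mathcal{B}(n,c,d)$). For $\mathbf{s}_n\in\mathcal{B}(n,c)$ let $E(\mathbf{s}_n)=\{R^k(\mathbf{s}_n):0\le k<n\}\cap\mathcal{B}(n,c)$, and let $\mathcal{R}(n,c)$ be the set of all $\widetilde{\mathbf{s}}_n$ such that, for some $\mathbf{s}_n\in\mathcal{B}(n,c)$, $\widetilde{\mathbf{s}}_n\in E(\mathbf{s}_n)$ and $add(\widetilde{\mathbf{s}}_n)\ge add(\mathbf{a}_n)$ for all $\mathbf{a}_n\in E(\mathbf{s}_n)$.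 **Theorem.** Let $n$ and $\omega$ be positive integers with $\lceil\log_2 n\rceil\le\omega\le n-1$. Then $$\mathcal{P}(n,\omega)\cong\{\mathbf{s}_n^\infty:\mathbf{s}_n\in S(n,\omega)\},$$ where $S(n,\omega)$ is given as follows: (i) if $\omega\le\frac n2$, then $S(n,\omega)=\{\mathbf{s}_n\in\mathcal{B}_0(n,\omega): L^k(\mathbf{s}_n)\notin\mathcal{B}(n,\omega+1)\text{ for all }0\le k<n\}$; (ii) if $\omega\ge\frac n2$, then $S(n,\omega)=\{\mathbf{s}_n\in\mathcal{R}(n,c): add(\mathbf{s}_n)=\omega-c\}$, where $c=\lceil\frac n2\rceil$. (If $\omega=\frac n2$, the equivalence holds with either choice of $S(n,\omega)$.) -/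

import Mathlib

namespace NLC

/-- The sequence `s_n^∞` obtained by repeating `s_n = (s_0, …, s_{n-1})` periodically. Its terms
with index below `n` are those of `s_n`. -/
def per {n : ℕ} [NeZero n] (s : Fin n → ZMod 2) : ℕ → ZMod 2 :=
  fun i => s (Fin.ofNat n i)

/-- The `m`-stage feedback shift register with feedback function `f` generates the infinite
sequence `a` (with initial state `(a_0, …, a_{m-1})`). -/
def Generates (m : ℕ) (f : (Fin m → ZMod 2) → ZMod 2) (a : ℕ → ZMod 2) : Prop :=
  ∀ i : ℕ, a (i + m) = f (fun j : Fin m => a (i + j))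

/-- `w` is the nonlinear complexity of `a`: the least length of a feedback shift register
that generates `a`. (Length `0` is only possible for constant sequences.) -/
def HasNLC (a : ℕ → ZMod 2) (w : ℕ) : Prop :=
  IsLeast {m : ℕ | ∃ f : (Fin m → ZMod 2) → ZMod 2, Generates m f a} w

/-- `n` is the least period of the infinite sequence `a`. -/
def HasLeastPeriod (a : ℕ → ZMod 2) (n : ℕ) : Prop :=
  IsLeast {p : ℕ | 0 < p ∧ Function.Periodic a p} n

/-- `P(n, w)`: the binary sequences of period `n` and nonlinear complexity `w`. -/
def P (n w : ℕ) : Set (ℕ → ZMod 2) :=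
  {a | HasLeastPeriod a n ∧ HasNLC a w}

/-- The left circular shift `L(s_0, …, s_{n-1}) = (s_1, …, s_{n-1}, s_0)`; the index `i + 1` is
taken modulo `n`. -/
def L {n : ℕ} [NeZero n] (s : Fin n → ZMod 2) : Fin n → ZMod 2 :=
  fun i => s (i + 1)

/-- The word `(u_0, …, u_{m-1})` is aperiodic: it is not a repetition `(u_0, …, u_{k-1})^e` of a
shorter word, `k` a proper divisor of `m`. -/
def Aperiodic (m : ℕ) (u : ℕ → ZMod 2) : Prop :=
  ¬ ∃ k : ℕ, k ∣ m ∧ k < m ∧ ∀ i < m, u i = u (i % k)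

/-- `B(n, c, d)`, for `1 ≤ c < n` and `1 ≤ d ≤ min {n - c, ⌊n/2⌋}`: the aperiodic binary words of
length `n` that start with `(s_0, …, s_{d-1})^q (s_0, …, s_{r-1}, s_r + 1)`, a word of length
`c + d` where `c + d - 1 = q d + r`, `0 ≤ r < d`, and `(s_0, …, s_{d-1})` is aperiodic. -/
def Bd (n c d : ℕ) [NeZero n] : Set (Fin n → ZMod 2) :=
  {s | (1 ≤ c ∧ c < n) ∧ (1 ≤ d ∧ d ≤ min (n - c) (n / 2)) ∧
    Aperiodic n (per s) ∧ Aperiodic d (per s) ∧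
    (∀ i < c + d - 1, per s i = per s (i % d)) ∧
    per s (c + d - 1) = per s ((c + d - 1) % d) + 1}

/-- `B(n, c)`: the union of all `B(n, c, d)`. -/
def B (n c : ℕ) [NeZero n] : Set (Fin n → ZMod 2) :=
  {s | ∃ d : ℕ, s ∈ Bd n c d}

/-- For the spacing `d`, the word `s` has exactly `t` added terms: `s_{n-1-i} = s_{(d-1-i) mod d}`
for `0 ≤ i < t`, but not for `i = t`. Here `d - 1 - i % d` is the residue of `d - 1 - i`
modulo `d` in `{0, …, d-1}`. -/
def AddedTerms {n : ℕ} [NeZero n] (s : Fin n → ZMod 2) (d t : ℕ) : Prop :=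
  t < n ∧ (∀ i < t, per s (n - 1 - i) = per s (d - 1 - i % d)) ∧
    per s (n - 1 - t) ≠ per s (d - 1 - t % d)

/-- `add(s) = t` for `s` in `B(n, c)`, with respect to a spacing `d` for which `s ∈ B(n, c, d)`. -/
def HasAdd {n : ℕ} [NeZero n] (c : ℕ) (s : Fin n → ZMod 2) (t : ℕ) : Prop :=
  ∃ d : ℕ, s ∈ Bd n c d ∧ AddedTerms s d t

/-- `B_0(n, c)`: the words in `B(n, c)` without added terms. -/
def B0 (n c : ℕ) [NeZero n] : Set (Fin n → ZMod 2) :=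
  {s | s ∈ B n c ∧ HasAdd c s 0}

/-- `E(s)`: the circular shifts of `s` (right shifts `R^k = L^{n-k}`) that lie in `B(n, c)`. -/
def E {n : ℕ} [NeZero n] (c : ℕ) (s : Fin n → ZMod 2) : Set (Fin n → ZMod 2) :=
  {a | (∃ k < n, a = L^[n - k] s) ∧ a ∈ B n c}

/-- `R(n, c)`: the representatives, that is, the words with the largest number of added terms in
the set `E(s)` of some `s ∈ B(n, c)`. -/
def R (n c : ℕ) [NeZero n] : Set (Fin n → ZMod 2) :=
  {r | ∃ s ∈ B n c, r ∈ E c s ∧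
    ∃ t : ℕ, HasAdd c r t ∧ ∀ a ∈ E c s, ∀ t' : ℕ, HasAdd c a t' → t' ≤ t}

/-- The set `S(n, w)` for `w ≤ n/2`. -/
def Ssmall (n w : ℕ) [NeZero n] : Set (Fin n → ZMod 2) :=
  {s | s ∈ B0 n w ∧ ∀ k < n, L^[k] s ∉ B n (w + 1)}

/-- The set `S(n, w)` for `w ≥ n/2`, with `c = ⌈n/2⌉ = (n + 1) / 2`. -/
def Slarge (n w : ℕ) [NeZero n] : Set (Fin n → ZMod 2) :=
  {s | s ∈ R n ((n + 1) / 2) ∧ HasAdd ((n + 1) / 2) s (w - (n + 1) / 2)}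

/-- The union of the cyclic shift equivalence classes of the members of a set of sequences of
period `n`. -/
def shiftClosure (n : ℕ) (S : Set (ℕ → ZMod 2)) : Set (ℕ → ZMod 2) :=
  {b | ∃ a ∈ S, ∃ k < n, b = fun i => a (i + k)}

/-- Cyclic shift equivalence of two sets of sequences of period `n`. -/
def ShiftEquiv (n : ℕ) (S₁ S₂ : Set (ℕ → ZMod 2)) : Prop :=
  shiftClosure n S₁ = shiftClosure n S₂

end NLC

/-!
For an `n`-periodic sequence `a`, a shift register of length `m` generates `a` unless two equal
windows of length `m` have different successors. Up to a shift, and exchanging the two windows if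
necessary, their distance is some `d ≤ n / 2`. So complexity at least `m + 1` means that some shift
of `a` agrees with its own translate by `d` on exactly the first `m` places (`Run`). Such a shift
begins with a maximal word of period `d` and length `m + d`, which is what membership in
`B(n, m + 1, d)` records once `d` is chosen minimal, so that the repeated block is aperiodic.

The terms counted by `add` prolong this periodic word to the left. Hence `add(s) = t` for
`s ∈ B(n, c)` yields a run of length `c - 1 + t`, and so complexity at least `c + t`
(`HasAdd.branch`). Conversely, if the complexity is `ω ≥ c` and `2 * c ≤ n + 1`, cutting a run of
length `ω - 1` after its first `ω - c` places gives a shift in `B(n, c)` with exactly `ω - c` added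
terms, because one more would give a run of length `ω` (`exists_hasAdd`). Both descriptions follow:
the case `c = ω` for small `ω`, and the case `c = ⌈n / 2⌉` for large `ω`. In the latter, the number
of added terms does not depend on the spacing, since for `n ≤ 2 * c` the spacing is unique
(`Bd_spacing_unique`).
-/

namespace NLC

/-! ### Nonlinear complexity and branching windows -/

/-- Two windows of length `m` in `a` are equal but have different successors. -/
def Branch (a : ℕ → ZMod 2) (m : ℕ) : Prop :=
  ∃ i j : ℕ, (∀ k < m, a (i + k) = a (j + k)) ∧ a (i + m) ≠ a (j + m)

theorem exists_generates_iff (a : ℕ → ZMod 2) (m : ℕ) :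
    (∃ f : (Fin m → ZMod 2) → ZMod 2, Generates m f a) ↔ ¬ Branch a m := by
  classical
  constructor
  · rintro ⟨f, hf⟩ ⟨i, j, h, hne⟩
    apply hne
    rw [hf i, hf j]
    congr 1
    funext k
    exact h k k.2
  · intro h
    refine ⟨fun v => if hv : ∃ i, v = fun j : Fin m => a (i + j) then a (hv.choose + m) else 0, ?_⟩
    intro i
    have hv : ∃ i', (fun j : Fin m => a (i + j)) = fun j : Fin m => a (i' + j) := ⟨i, rfl⟩
    simp only [dif_pos hv]
    by_contra hne
    exact h ⟨i, hv.choose, fun k hk => congrFun hv.choose_spec ⟨k, hk⟩, hne⟩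

theorem Branch.of_succ {a : ℕ → ZMod 2} {m : ℕ} (h : Branch a (m + 1)) : Branch a m := by
  obtain ⟨i, j, h, hne⟩ := h
  refine ⟨i + 1, j + 1, fun k hk => ?_, ?_⟩
  · have := h (k + 1) (by omega)
    rwa [← add_assoc, ← add_assoc, add_right_comm i, add_right_comm j] at this
  · rwa [add_right_comm i, add_right_comm j, add_assoc i, add_assoc j]

theorem Branch.mono {a : ℕ → ZMod 2} {m m' : ℕ} (h : Branch a m) (hm : m' ≤ m) :
    Branch a m' :=
  Nat.decreasingInduction (motive := fun k _ => Branch a k) (fun _ _ h => h.of_succ) h hm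

theorem hasNLC_succ_iff (a : ℕ → ZMod 2) (m : ℕ) :
    HasNLC a (m + 1) ↔ Branch a m ∧ ¬ Branch a (m + 1) := by
  simp only [HasNLC, exists_generates_iff]
  constructor
  · rintro ⟨h1, h2⟩
    refine ⟨?_, h1⟩
    by_contra h
    exact absurd (h2 h) (by omega)
  · rintro ⟨h1, h2⟩
    refine ⟨h2, fun k hk => ?_⟩
    by_contra hlt
    exact hk (h1.mono (by omega))

theorem Branch.of_shift {a : ℕ → ZMod 2} {p m : ℕ} (h : Branch (fun i => a (p + i)) m) :
    Branch a m := by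
  obtain ⟨i, j, h, hne⟩ := h
  refine ⟨p + i, p + j, fun k hk => ?_, ?_⟩
  · rw [add_assoc, add_assoc]; exact h k hk
  · rw [add_assoc, add_assoc]; exact hne

/-! ### Shifts of periodic sequences -/

theorem periodic_mul {a : ℕ → ZMod 2} {n : ℕ} (ha : Function.Periodic a n) (i k : ℕ) :
    a (i + k * n) = a i := by
  simpa using ha.nat_mul k i

theorem periodic_mod {a : ℕ → ZMod 2} {n : ℕ} (ha : Function.Periodic a n) (p i : ℕ) :
    a (p + i % n) = a (p + i) := by
  conv_rhs => rw [← Nat.mod_add_div i n, mul_comm, ← add_assoc]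
  rw [periodic_mul ha]

theorem Periodic.shift {a : ℕ → ZMod 2} {n : ℕ} (ha : Function.Periodic a n) (p : ℕ) :
    Function.Periodic (fun i => a (p + i)) n := fun i => by
  simp only [← add_assoc, ha _]

/-- Shifting by `p` and then by `(n - 1) * p` is the identity on `n`-periodic sequences. -/
theorem periodic_shift_back {a : ℕ → ZMod 2} {n : ℕ} [NeZero n] (ha : Function.Periodic a n)
    (p i : ℕ) : a (p + ((n - 1) * p + i)) = a i := by
  obtain ⟨m, rfl⟩ := Nat.exists_eq_succ_of_ne_zero (NeZero.ne n)
  rw [← periodic_mul ha i p]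
  congr 1
  simp only [Nat.succ_eq_add_one, Nat.add_sub_cancel]
  ring

theorem per_periodic {n : ℕ} [NeZero n] (s : Fin n → ZMod 2) : Function.Periodic (per s) n := by
  intro i
  simp [per, Fin.ofNat]

/-- The word `(a_p, …, a_{p+n-1})`. -/
def window (n : ℕ) (a : ℕ → ZMod 2) (p : ℕ) : Fin n → ZMod 2 := fun i => a (p + i)

theorem per_window {n : ℕ} [NeZero n] {a : ℕ → ZMod 2} (ha : Function.Periodic a n) (p : ℕ) :
    per (window n a p) = fun i => a (p + i) := by
  funext i
  simpa [per, window, Fin.ofNat] using periodic_mod ha p i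

theorem window_shift (n : ℕ) (a : ℕ → ZMod 2) (q p : ℕ) :
    window n (fun i => a (q + i)) p = window n a (q + p) := by
  funext i
  simp only [window, add_assoc]

theorem window_per {n : ℕ} [NeZero n] (s : Fin n → ZMod 2) : window n (per s) 0 = s := by
  funext i
  simp only [window, per, zero_add]
  congr 1
  ext
  simp [Fin.ofNat, Nat.mod_eq_of_lt i.2]

theorem L_iterate {n : ℕ} [NeZero n] (s : Fin n → ZMod 2) (k : ℕ) :
    L^[k] s = window n (per s) k := by
  induction k with
  | zero => exact (window_per s).symm
  | succ k ih =>
    rw [Function.iterate_succ_apply', ih]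
    funext i
    simp only [L, window, Fin.val_add, Fin.val_one']
    rw [Nat.add_mod_mod, periodic_mod (per_periodic s)]
    congr 1
    omega

/-- The least period of an `n`-periodic sequence is `n` exactly if no proper divisor of `n` is a
period. -/
theorem hasLeastPeriod_iff {n : ℕ} [NeZero n] {a : ℕ → ZMod 2} (ha : Function.Periodic a n) :
    HasLeastPeriod a n ↔ Aperiodic n a := by
  have hn : 0 < n := NeZero.pos n
  constructor
  · rintro ⟨-, h⟩ ⟨k, hk, hkn, hp⟩
    have hk0 : 0 < k := Nat.pos_of_dvd_of_pos hk hn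
    refine absurd (h ⟨hk0, fun i => ?_⟩) (not_le.2 hkn)
    have key : ∀ j, a j = a (j % k) := fun j => by
      have h1 := periodic_mod ha 0 j
      rw [zero_add, zero_add] at h1
      rw [← h1, hp _ (Nat.mod_lt _ hn), Nat.mod_mod_of_dvd _ hk]
    rw [key (i + k), key i, Nat.add_mod_right]
  · intro h
    refine ⟨⟨hn, ha⟩, ?_⟩
    classical
    have hex : ∃ p, 0 < p ∧ Function.Periodic a p := ⟨n, hn, ha⟩
    obtain ⟨hq0, hq⟩ := Nat.find_spec hex
    set q := Nat.find hex with hqdef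
    have hmin : ∀ p, 0 < p ∧ Function.Periodic a p → q ≤ p := fun p hp => Nat.find_min' hex hp
    have hdvd : q ∣ n := by
      by_contra hnd
      have hpos : 0 < n % q := Nat.pos_of_ne_zero fun h0 => hnd (Nat.dvd_of_mod_eq_zero h0)
      refine absurd (hmin (n % q) ⟨hpos, fun i => ?_⟩) (not_le.2 (Nat.mod_lt _ hq0))
      rw [periodic_mod hq, ha]
    have hqn : q = n := by
      by_contra hne
      refine h ⟨q, hdvd, lt_of_le_of_ne (Nat.le_of_dvd hn hdvd) hne, fun i _ => ?_⟩
      have := periodic_mod hq 0 i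
      rw [zero_add, zero_add] at this
      exact this.symm
    rw [← hqn]
    exact fun p hp => hmin p hp

theorem HasLeastPeriod.shift {a : ℕ → ZMod 2} {n : ℕ} [NeZero n] (h : HasLeastPeriod a n) (p : ℕ) :
    HasLeastPeriod (fun i => a (p + i)) n := by
  refine ⟨⟨NeZero.pos n, Periodic.shift h.1.2 p⟩, fun q hq => h.2 ⟨hq.1, fun i => ?_⟩⟩
  have := hq.2 ((n - 1) * p + i)
  simp only [add_assoc] at this
  rwa [periodic_shift_back h.1.2, periodic_shift_back h.1.2] at this

/-! ### Runs -/

/-- From place `p` on, `a` agrees with its translate by `d` on exactly `m` consecutive places. -/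
def Run (a : ℕ → ZMod 2) (p m d : ℕ) : Prop :=
  (∀ k < m, a (p + k) = a (p + k + d)) ∧ a (p + m) ≠ a (p + m + d)

theorem Run.branch {a : ℕ → ZMod 2} {p m d : ℕ} (h : Run a p m d) : Branch a m := by
  refine ⟨p, p + d, fun k hk => ?_, ?_⟩
  · rw [h.1 k hk, add_right_comm]
  · rw [add_right_comm p d m]; exact h.2

theorem Run.pos {a : ℕ → ZMod 2} {p m d : ℕ} (h : Run a p m d) : 0 < d :=
  Nat.pos_of_ne_zero fun h0 => h.2 (by rw [h0, add_zero])

/-- Inside a run of length `m` with spacing `d`, a window of length `m + d` is the periodic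
repetition of its first `d` terms. -/
theorem Run.mod {a : ℕ → ZMod 2} {p m d : ℕ} (h : Run a p m d) {i : ℕ} (hi : i < m + d) :
    a (p + i) = a (p + i % d) := by
  induction i using Nat.strong_induction_on with
  | _ i ih =>
    by_cases hid : i < d
    · rw [Nat.mod_eq_of_lt hid]
    · have hd := h.pos
      have h1 := h.1 (i - d) (by omega)
      rw [show p + (i - d) + d = p + i by omega] at h1
      rw [← h1, ih (i - d) (by omega) (by omega), ← Nat.mod_eq_sub_mod (by omega)]

theorem Run.congr_mod {a : ℕ → ZMod 2} {p m d i j : ℕ} (h : Run a p m d) (hi : i < m + d)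
    (hj : j < m + d) (hij : i ≡ j [MOD d]) : a (p + i) = a (p + j) := by
  rw [h.mod hi, h.mod hj, hij]

theorem Run.drop {a : ℕ → ZMod 2} {p m d e : ℕ} (h : Run a p (e + m) d) : Run a (p + e) m d := by
  refine ⟨fun k hk => ?_, ?_⟩
  · have := h.1 (e + k) (by omega)
    rwa [← add_assoc] at this
  · rw [add_assoc p]; exact h.2

/-- In an `n`-periodic sequence a run of length `m ≥ d` cannot have spacing `d = n / 2`: the
agreement at `m - d` forces agreement at `m`. -/
theorem Run.lt_of_two_mul {a : ℕ → ZMod 2} {n p m d : ℕ} (ha : Function.Periodic a n)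
    (h : Run a p m d) (hn : n = 2 * d) : m < d := by
  by_contra hlt
  have hd := h.pos
  have h1 := h.1 (m - d) (by omega)
  apply h.2
  rw [show p + (m - d) + d = p + m by omega] at h1
  rw [← h1, ← ha, hn]
  congr 1
  omega

/-- The length of a run in an `n`-periodic sequence is less than `n`. -/
theorem Run.length_lt {a : ℕ → ZMod 2} {n p m d : ℕ} [NeZero n] (ha : Function.Periodic a n)
    (h : Run a p m d) : m < n := by
  by_contra hlt
  have hn : 0 < n := NeZero.pos n
  have h1 := h.1 (m - n) (by omega)
  apply h.2
  rw [← ha, ← ha (p + (m - n) + d)] at h1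
  rw [show p + (m - n) + n = p + m by omega] at h1
  rw [h1]
  congr 1
  omega

/-- Branching windows of a periodic sequence can be taken at distance at most `n / 2`, by going
around the cycle in the other direction if necessary. -/
theorem Branch.exists_run {a : ℕ → ZMod 2} {n m : ℕ} [NeZero n] (ha : Function.Periodic a n)
    (h : Branch a m) : ∃ p d, d ≤ n / 2 ∧ Run a p m d := by
  have hn : 0 < n := NeZero.pos n
  obtain ⟨i, j, h, hne⟩ := h
  have red : ∀ i k, a (i + k) = a (i % n + k) := fun i k => by
    rw [add_comm i, add_comm (i % n), periodic_mod ha]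
  -- The statement is symmetric in the two places, so these may be ordered.
  have key : ∀ i j, i < n → j < n → i ≤ j → (∀ k < m, a (i + k) = a (j + k)) →
      a (i + m) ≠ a (j + m) → ∃ p d, d ≤ n / 2 ∧ Run a p m d := by
    intro i j hi hj hij h hne
    by_cases hd : j - i ≤ n / 2
    · refine ⟨i, j - i, hd, fun k hk => ?_, ?_⟩
      · rw [h k hk]; congr 1; omega
      · rwa [show i + m + (j - i) = j + m by omega]
    · refine ⟨j, n - (j - i), by omega, fun k hk => ?_, ?_⟩
      · rw [← h k hk, ← ha]; congr 1; omega
      · rw [show j + m + (n - (j - i)) = i + m + n by omega, ha]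
        exact hne.symm
  simp only [red i, red j] at h hne
  rcases le_total (i % n) (j % n) with hij | hij
  · exact key _ _ (Nat.mod_lt _ hn) (Nat.mod_lt _ hn) hij h hne
  · exact key _ _ (Nat.mod_lt _ hn) (Nat.mod_lt _ hn) hij (fun k hk => (h k hk).symm) hne.symm

/-- If the block `(a_p, …, a_{p+d-1})` of a run is a repetition of a word of length `k`, then the
end of the run is a run of the same length with spacing `k`. -/
theorem Run.reduce {a : ℕ → ZMod 2} {p m d k : ℕ} (h : Run a p m d) (hk : k ∣ d) (hkd : k < d)
    (hp : ∀ i < d, a (p + i) = a (p + i % k)) : Run a (p + (d - k)) m k := by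
  have hd := h.pos
  have hk0 : 0 < k := Nat.pos_of_dvd_of_pos hk hd
  have key : ∀ i < m + d, a (p + i) = a (p + i % k) := fun i hi => by
    rw [h.mod hi, hp _ (Nat.mod_lt _ hd), Nat.mod_mod_of_dvd _ hk]
  have hmod : ∀ i, (d - k + i) % k = i % k := fun i => by
    obtain ⟨e, rfl⟩ := hk
    rw [← Nat.mul_sub_one, Nat.mul_add_mod]
  refine ⟨fun i hi => ?_, ?_⟩
  · rw [add_assoc, add_assoc, add_assoc, key _ (by omega), key (d - k + (i + k)) (by omega),
      hmod, hmod, Nat.add_mod_right]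
  · rw [add_assoc p, key _ (by omega), hmod, ← key m (by omega),
      show p + (d - k + m) + k = p + m + d by omega]
    exact h.2

theorem Branch.exists_run_aperiodic {a : ℕ → ZMod 2} {n m : ℕ} [NeZero n]
    (ha : Function.Periodic a n) (h : Branch a m) :
    ∃ p d, d ≤ n / 2 ∧ Run a p m d ∧ Aperiodic d (fun i => a (p + i)) := by
  classical
  obtain ⟨p₀, d₀, hd₀, h₀⟩ := h.exists_run ha
  have hex : ∃ d, ∃ p, Run a p m d := ⟨d₀, p₀, h₀⟩
  obtain ⟨p, hp⟩ := Nat.find_spec hex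
  refine ⟨p, Nat.find hex, (Nat.find_min' hex ⟨p₀, h₀⟩).trans hd₀, hp, ?_⟩
  rintro ⟨k, hk, hkd, hper⟩
  exact Nat.find_min hex hkd ⟨_, hp.reduce hk hkd hper⟩

/-- Rotating a word by one place preserves aperiodicity. -/
theorem Aperiodic.rotate {a : ℕ → ZMod 2} {p d : ℕ} (h : Aperiodic d (fun i => a (p + i)))
    (hp : a p = a (p + d)) : Aperiodic d (fun i => a (p + 1 + i)) := by
  rintro ⟨k, hk, hkd, hper⟩
  refine h ⟨k, hk, hkd, fun i hi => ?_⟩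
  have hk0 : 0 < k := Nat.pos_of_dvd_of_pos hk (by omega)
  -- The last term of the rotated word is both `a (p + d) = a p` and `a (p + k)`.
  have last : ∀ j, 0 < j → j ≤ d → j % k = 0 → a (p + j) = a (p + k) := fun j hj hjd hj0 => by
    have h1 := hper (j - 1) (by omega)
    have h2 : (j - 1) % k = k - 1 := by
      obtain ⟨e, rfl⟩ := Nat.dvd_of_mod_eq_zero hj0
      obtain ⟨e, rfl⟩ := Nat.exists_eq_succ_of_ne_zero (show e ≠ 0 by rintro rfl; simp at hj)
      rw [Nat.succ_eq_add_one, mul_add_one, Nat.add_sub_assoc hk0, Nat.mul_add_mod,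
        Nat.mod_eq_of_lt (by omega)]
    simp only [h2] at h1
    rwa [show p + 1 + (j - 1) = p + j by omega, show p + 1 + (k - 1) = p + k by omega] at h1
  simp only
  by_cases hi0 : i = 0
  · rw [hi0, Nat.zero_mod]
  by_cases him : i % k = 0
  · rw [him, add_zero, hp, last i (by omega) hi.le him,
      last d (by omega) le_rfl (Nat.mod_eq_zero_of_dvd hk)]
  · have h1 := hper (i - 1) (by omega)
    have h2 : (i - 1) % k = i % k - 1 := by
      have hlt := Nat.mod_lt i hk0
      conv_lhs => rw [← Nat.div_add_mod i k]
      rw [Nat.add_sub_assoc (by omega), Nat.mul_add_mod, Nat.mod_eq_of_lt (by omega)]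
    simp only [h2] at h1
    rwa [show p + 1 + (i - 1) = p + i by omega,
      show p + 1 + (i % k - 1) = p + i % k by omega] at h1

theorem Run.aperiodic_drop {a : ℕ → ZMod 2} {p m d : ℕ} (h : Run a p m d)
    (hu : Aperiodic d (fun i => a (p + i))) {e : ℕ} (he : e ≤ m) :
    Aperiodic d (fun i => a (p + e + i)) := by
  induction e with
  | zero => exact hu
  | succ e ih => exact (ih (by omega)).rotate (h.1 e (by omega))

/-! ### Runs and the sets `B(n, c)` -/

theorem zmod_two_ne_iff (x y : ZMod 2) : x ≠ y ↔ y = x + 1 := by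
  revert x y
  decide

theorem run_of_mem_Bd {n c d : ℕ} [NeZero n] {s : Fin n → ZMod 2} (h : s ∈ Bd n c d) :
    Run (per s) 0 (c - 1) d := by
  obtain ⟨⟨hc, -⟩, ⟨hd, -⟩, -, -, h1, h2⟩ := h
  refine ⟨fun k hk => ?_, ?_⟩
  · rw [zero_add, h1 k (by omega), h1 (k + d) (by omega), Nat.add_mod_right]
  · rw [zmod_two_ne_iff, zero_add, show c - 1 + d = c + d - 1 by omega, h2, h1 (c - 1) (by omega),
      show c + d - 1 = c - 1 + d by omega, Nat.add_mod_right]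

/-- Cutting off the first `e` places of a run with aperiodic block gives a word in `B(n, c, d)`. -/
theorem Run.window_mem_Bd {a : ℕ → ZMod 2} {n p e c d : ℕ} [NeZero n] (ha : HasLeastPeriod a n)
    (h : Run a p (e + c) d) (hu : Aperiodic d (fun i => a (p + i))) (hd : d ≤ n / 2)
    (hc : c ≤ n / 2) : window n a (p + e) ∈ Bd n (c + 1) d := by
  have hper := ha.1.2
  have hd0 := h.pos
  have h' := h.drop
  have hdc : d ≤ n - (c + 1) := by
    by_contra hlt
    have := h'.lt_of_two_mul hper (by omega)
    omega
  refine ⟨⟨by omega, by omega⟩, ⟨hd0, by omega⟩, ?_⟩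
  rw [per_window hper]
  refine ⟨(hasLeastPeriod_iff (Periodic.shift hper _)).1 (ha.shift _),
    h.aperiodic_drop hu (by omega), fun i hi => h'.mod (by omega), ?_⟩
  simp only
  rw [show c + 1 + d - 1 = c + d by omega, Nat.add_mod_right, ← h'.mod (by omega),
    ← zmod_two_ne_iff, ← add_assoc]
  exact h'.2

theorem Branch.exists_mem_B {a : ℕ → ZMod 2} {n m : ℕ} [NeZero n] (ha : HasLeastPeriod a n)
    (h : Branch a m) (hm : m ≤ n / 2) : ∃ p, window n a p ∈ B n (m + 1) := by
  obtain ⟨p, d, hd, hrun, hu⟩ := h.exists_run_aperiodic ha.1.2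
  exact ⟨p + 0, d, Run.window_mem_Bd ha (by rwa [zero_add]) hu hd hm⟩

/-- A sequence of complexity `e + c + 1` has a shift in `B(n, c + 1)` with exactly `e` added
terms. -/
theorem exists_hasAdd {a : ℕ → ZMod 2} {n e c : ℕ} [NeZero n] (ha : HasLeastPeriod a n)
    (h : Branch a (e + c)) (h' : ¬ Branch a (e + c + 1)) (hc : c ≤ n / 2) :
    ∃ p, HasAdd (c + 1) (window n a p) e := by
  have hper := ha.1.2
  obtain ⟨p, d, hd, hrun, hu⟩ := h.exists_run_aperiodic hper
  have hd0 := hrun.pos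
  have hen : e + c < n := hrun.length_lt hper
  have hmod : ∀ i, (e + (d - 1 - i % d)) + i ≡ e + (d - 1) [MOD d] := fun i => by
    have hlt := Nat.mod_lt i hd0
    calc e + (d - 1 - i % d) + i ≡ e + (d - 1 - i % d) + i % d [MOD d] :=
          Nat.ModEq.add_left _ (Nat.mod_modEq i d).symm
      _ = e + (d - 1) := by omega
  refine ⟨p + e, d, Run.window_mem_Bd ha hrun hu hd hc, by omega, fun i hi => ?_, ?_⟩
  · rw [per_window hper]
    simp only
    rw [show p + e + (n - 1 - i) = p + (e - 1 - i) + n by omega, hper, add_assoc]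
    refine hrun.congr_mod (by omega) (by omega) (Nat.ModEq.add_right_cancel' i ?_)
    refine Nat.ModEq.trans ?_ (hmod i).symm
    rw [show e - 1 - i + i = e - 1 by omega, show e + (d - 1) = e - 1 + d by omega]
    simp [Nat.ModEq]
  · -- One more added term would give a run of length `e + c + 1` that starts one place earlier.
    rw [per_window hper]
    simp only
    rw [show p + e + (n - 1 - e) = p + (n - 1) by omega, add_assoc]
    have hlt := Nat.mod_lt e hd0
    rw [hrun.congr_mod (i := e + (d - 1 - e % d)) (j := d - 1) (by omega) (by omega)
      (Nat.ModEq.add_right_cancel' e ((hmod e).trans (by rw [add_comm])))]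
    intro heq
    have hrun' : Run a (p + (n - 1)) (e + c + 1) d := by
      refine ⟨fun k hk => ?_, ?_⟩
      · rcases k with _ | k
        · rw [add_zero, heq, ← hper]
          congr 1
          omega
        · rw [show p + (n - 1) + (k + 1) = p + k + n by omega, hper, hrun.1 k (by omega), ← hper]
          congr 1
          omega
      · rw [show p + (n - 1) + (e + c + 1) = p + (e + c) + n by omega, hper,
          show p + (e + c) + n + d = p + (e + c) + d + n by omega, hper]
        exact hrun.2
    exact h' hrun'.branch

/-- Added terms prolong a run to the left. -/
theorem HasAdd.branch {n c t : ℕ} [NeZero n] {s : Fin n → ZMod 2} (h : HasAdd c s t) :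
    Branch (per s) (c - 1 + t) := by
  obtain ⟨d, hB, ht, hadd, -⟩ := h
  have hper := per_periodic s
  have hrun := run_of_mem_Bd hB
  have hd := hrun.pos
  refine Run.branch (p := n - t) (d := d) ⟨fun k hk => ?_, ?_⟩
  · by_cases hkt : t ≤ k
    · have h1 := hrun.1 (k - t) (by omega)
      rw [zero_add] at h1
      rw [show n - t + k = k - t + n by omega, hper, h1, ← hper]
      congr 1
      omega
    · have h1 := hadd (t - 1 - k) (by omega)
      rw [show n - 1 - (t - 1 - k) = n - t + k by omega] at h1
      rw [h1]
      by_cases hid : d ≤ t - 1 - k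
      · have h2 := hadd (t - 1 - k - d) (by omega)
        rw [show n - 1 - (t - 1 - k - d) = n - t + k + d by omega,
          ← Nat.mod_eq_sub_mod hid] at h2
        exact h2.symm
      · rw [Nat.mod_eq_of_lt (by omega), ← hper]
        congr 1
        omega
  · have h1 := hrun.2
    rw [zero_add] at h1
    rw [show n - t + (c - 1 + t) = c - 1 + n by omega, hper,
      show c - 1 + n + d = c - 1 + d + n by omega, hper]
    exact h1

/-- Two runs from the same place with spacings `d < d'`, where `d' ≤ m + 1`, cannot have the same
length `m`. The sum of `a (x + d) - a x` over the `d'` places up to `m` telescopes to a sum of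
differences with spacing `d'`, which vanishes, while exactly its last term is nonzero. -/
theorem Run.false_of_spacing_lt {a : ℕ → ZMod 2} {p m d d' : ℕ} (h : Run a p m d)
    (h' : Run a p m d') (hlt : d < d') (hm : d' ≤ m + 1) : False := by
  obtain ⟨D, rfl⟩ := Nat.exists_eq_succ_of_ne_zero (show d' ≠ 0 by omega)
  obtain ⟨e, rfl⟩ := Nat.exists_eq_add_of_le (show D ≤ m by omega)
  set b : ℕ → ZMod 2 := fun k => a (p + e + k) with hb
  have h1 : ∀ k < D, b (d + k) = b k := fun k hk => by
    have := h.1 (e + k) (by omega)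
    simp only [hb]
    rw [show p + e + k = p + (e + k) by omega, this]
    congr 1
    omega
  have h2 : ∀ k < d, b (D + 1 + k) = b k := fun k hk => by
    have := h'.1 (e + k) (by omega)
    simp only [hb]
    rw [show p + e + k = p + (e + k) by omega, this]
    congr 1
    omega
  have e1 := Finset.sum_range_add b d (D + 1)
  have e2 := Finset.sum_range_add b (D + 1) d
  rw [add_comm (D + 1) d, e1, Finset.sum_congr rfl fun k hk => h2 k (Finset.mem_range.1 hk),
    add_comm, add_left_inj, Finset.sum_range_succ, Finset.sum_range_succ,
    Finset.sum_congr rfl fun k hk => h1 k (Finset.mem_range.1 hk), add_right_inj] at e2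
  apply h.2
  simp only [hb] at e2
  rw [show p + (D + e) = p + e + D by omega, ← e2]
  congr 1
  omega

theorem Bd_spacing_unique {n c d d' : ℕ} [NeZero n] {s : Fin n → ZMod 2} (hc : n ≤ 2 * c)
    (h : s ∈ Bd n c d) (h' : s ∈ Bd n c d') : d = d' := by
  have hr := run_of_mem_Bd h
  have hr' := run_of_mem_Bd h'
  obtain ⟨⟨hc1, -⟩, ⟨-, hd⟩, -⟩ := h
  obtain ⟨-, ⟨-, hd'⟩, -⟩ := h'
  rcases lt_trichotomy d d' with hlt | heq | hlt
  · exact (hr.false_of_spacing_lt hr' hlt (by omega)).elim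
  · exact heq
  · exact (hr'.false_of_spacing_lt hr hlt (by omega)).elim

theorem HasAdd.unique {n c t t' : ℕ} [NeZero n] {s : Fin n → ZMod 2} (hc : n ≤ 2 * c)
    (h : HasAdd c s t) (h' : HasAdd c s t') : t = t' := by
  obtain ⟨d, hB, -, h1, h2⟩ := h
  obtain ⟨d', hB', -, h1', h2'⟩ := h'
  obtain rfl := Bd_spacing_unique hc hB hB'
  rcases lt_trichotomy t t' with hlt | heq | hlt
  · exact (h2 (h1' t hlt)).elim
  · exact heq
  · exact (h2' (h1 t' hlt)).elim

theorem HasAdd.mem_B {n c t : ℕ} [NeZero n] {s : Fin n → ZMod 2} (h : HasAdd c s t) :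
    s ∈ B n c :=
  h.imp fun _ hd => hd.1

theorem hasLeastPeriod_of_mem_B {n c : ℕ} [NeZero n] {s : Fin n → ZMod 2} (h : s ∈ B n c) :
    HasLeastPeriod (per s) n := by
  obtain ⟨d, -, -, h, -⟩ := h
  exact (hasLeastPeriod_iff (per_periodic s)).2 h

theorem branch_of_mem_B {n c : ℕ} [NeZero n] {s : Fin n → ZMod 2} (h : s ∈ B n c) :
    Branch (per s) (c - 1) := by
  obtain ⟨d, h⟩ := h
  exact (run_of_mem_Bd h).branch

/-- The words in `E(s)` are the words in `B(n, c)` among all windows of `s^∞`. -/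
theorem mem_E_iff {n c : ℕ} [NeZero n] {s r : Fin n → ZMod 2} :
    r ∈ E c s ↔ (∃ p, r = window n (per s) p) ∧ r ∈ B n c := by
  have hn : 0 < n := NeZero.pos n
  refine and_congr_left fun _ => ⟨?_, ?_⟩
  · rintro ⟨k, -, rfl⟩
    exact ⟨_, L_iterate _ _⟩
  · rintro ⟨p, rfl⟩
    -- `R^k` with `k ≡ -p` modulo `n`
    refine ⟨((n - 1) * p) % n, Nat.mod_lt _ hn, ?_⟩
    rw [L_iterate]
    have hlt := Nat.mod_lt ((n - 1) * p) hn
    funext i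
    simp only [window]
    rw [← periodic_shift_back (per_periodic s) p (n - (n - 1) * p % n + i),
      ← periodic_mul (per_periodic s) (p + i) ((n - 1) * p / n + 1)]
    congr 1
    have hdiv := Nat.mod_add_div ((n - 1) * p) n
    rw [add_one_mul, mul_comm _ n]
    omega

/-! ### The representatives of the shift classes -/

/-- A set `S` of words represents `P(n, ω)` up to shifts if it generates members of `P(n, ω)` only
and contains a window of every member. -/
theorem shiftEquiv_per {n ω : ℕ} [NeZero n] {S : Set (Fin n → ZMod 2)}
    (h1 : ∀ s ∈ S, per s ∈ P n ω) (h2 : ∀ a ∈ P n ω, ∃ p, window n a p ∈ S) :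
    ShiftEquiv n (P n ω) (per '' S) := by
  apply Set.Subset.antisymm
  · rintro b ⟨a, ha, k, -, rfl⟩
    obtain ⟨p, hp⟩ := h2 a ha
    have hper := ha.1.1.2
    refine ⟨_, ⟨_, hp, rfl⟩, ((n - 1) * p + k) % n, Nat.mod_lt _ (NeZero.pos n), ?_⟩
    funext i
    rw [periodic_mod (per_periodic _), per_window hper, ← periodic_shift_back hper p (i + k)]
    congr 1
    omega
  · rintro b ⟨-, ⟨s, hs, rfl⟩, k, hk, rfl⟩
    exact ⟨_, h1 s hs, k, hk, rfl⟩

/-- The complexity of a periodic sequence is bounded, so branching windows have a largest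
length. -/
theorem Branch.exists_max {a : ℕ → ZMod 2} {n m : ℕ} [NeZero n] (ha : Function.Periodic a n)
    (h : Branch a m) : ∃ w, m ≤ w ∧ Branch a w ∧ ¬ Branch a (w + 1) := by
  by_contra! hcon
  have key : ∀ k, Branch a (m + k) := fun k => by
    induction k with
    | zero => exact h
    | succ k ih => exact hcon (m + k) (by omega) ih
  obtain ⟨p, d, -, hrun⟩ := (key n).exists_run ha
  have := hrun.length_lt ha
  omega

theorem shiftEquiv_small {n m : ℕ} [NeZero n] (hm : 2 * (m + 1) ≤ n) :
    ShiftEquiv n (P n (m + 1)) (per '' Ssmall n (m + 1)) := by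
  refine shiftEquiv_per ?_ ?_
  · rintro s ⟨⟨hB, -⟩, hL⟩
    have hlp := hasLeastPeriod_of_mem_B hB
    refine ⟨hlp, (hasNLC_succ_iff _ _).2 ⟨branch_of_mem_B hB, fun h => ?_⟩⟩
    obtain ⟨p, hp⟩ := h.exists_mem_B hlp (by omega)
    refine hL (p % n) (Nat.mod_lt _ (NeZero.pos n)) ?_
    rw [L_iterate]
    convert hp using 1
    funext i
    simp only [window]
    rw [add_comm, periodic_mod (per_periodic s), add_comm]
  · rintro a ⟨hlp, hN⟩
    obtain ⟨h1, h2⟩ := (hasNLC_succ_iff _ _).1 hN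
    obtain ⟨p, hp⟩ := exists_hasAdd (e := 0) (c := m) hlp (by rwa [zero_add])
      (by rwa [zero_add]) (by omega)
    refine ⟨p, ⟨hp.mem_B, hp⟩, fun k _ hk => h2 ?_⟩
    have h3 := branch_of_mem_B hk
    rw [L_iterate, per_window (per_periodic _), per_window hlp.1.2] at h3
    exact h3.of_shift (a := fun i => a (p + i)) |>.of_shift

theorem shiftEquiv_large {n m : ℕ} [NeZero n] (hn : 2 ≤ n) (hm : n ≤ 2 * (m + 1)) :
    ShiftEquiv n (P n (m + 1)) (per '' Slarge n (m + 1)) := by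
  obtain ⟨c, hc⟩ := Nat.exists_eq_succ_of_ne_zero (show (n + 1) / 2 ≠ 0 by omega)
  rw [Nat.succ_eq_add_one] at hc
  have hsub : m + 1 - (c + 1) + c = m := by omega
  refine shiftEquiv_per ?_ ?_
  · rintro s ⟨⟨s₀, -, hE, t, ht, hmax⟩, hadd⟩
    rw [hc] at hE ht hmax hadd
    obtain rfl := ht.unique (by omega) hadd
    have hlp := hasLeastPeriod_of_mem_B ht.mem_B
    refine ⟨hlp, (hasNLC_succ_iff _ _).2 ⟨?_, fun h => ?_⟩⟩
    · have := ht.branch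
      rwa [Nat.add_sub_cancel, add_comm, hsub] at this
    · -- A larger complexity would give a word in `E(s₀)` with more added terms.
      obtain ⟨w, hmw, hw, hw'⟩ := h.exists_max hlp.1.2
      have hwc : w - c + c = w := by omega
      obtain ⟨p, hp⟩ := exists_hasAdd (e := w - c) (c := c) hlp (by rwa [hwc]) (by rwa [hwc])
        (by omega)
      obtain ⟨⟨q, rfl⟩, -⟩ := mem_E_iff.1 hE
      rw [per_window (per_periodic _), window_shift] at hp
      have := hmax _ (mem_E_iff.2 ⟨⟨_, rfl⟩, hp.mem_B⟩) _ hp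
      omega
  · rintro a ⟨hlp, hN⟩
    obtain ⟨h1, h2⟩ := (hasNLC_succ_iff _ _).1 hN
    obtain ⟨p, hp⟩ := exists_hasAdd (e := m + 1 - (c + 1)) (c := c) hlp (by rwa [hsub])
      (by rwa [hsub]) (by omega)
    refine ⟨p, ?_, by rwa [hc]⟩
    rw [R, hc]
    refine ⟨_, hp.mem_B, mem_E_iff.2 ⟨⟨0, (window_per _).symm⟩, hp.mem_B⟩, _, hp, ?_⟩
    intro r hr t' ht'
    obtain ⟨⟨q, rfl⟩, -⟩ := mem_E_iff.1 hr
    have h3 := ht'.branch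
    rw [per_window (per_periodic _), per_window hlp.1.2] at h3
    have h4 : Branch a (c + t') := by
      simpa using h3.of_shift (a := fun i => a (p + i)) |>.of_shift
    by_contra hlt
    exact h2 (h4.mono (by omega))

end NLC

theorem theorem3 (n ω : ℕ) [NeZero n] (hω : 0 < ω)
    (hlow : Nat.clog 2 n ≤ ω) (hhigh : ω ≤ n - 1) :
    (2 * ω ≤ n → NLC.ShiftEquiv n (NLC.P n ω) (NLC.per '' NLC.Ssmall n ω)) ∧
    (n ≤ 2 * ω → NLC.ShiftEquiv n (NLC.P n ω) (NLC.per '' NLC.Slarge n ω)) := by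
  obtain ⟨m, rfl⟩ := Nat.exists_eq_succ_of_ne_zero hω.ne'
  exact ⟨NLC.shiftEquiv_small, NLC.shiftEquiv_large (by omega)⟩
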